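/- Let $\mathcal{B}$ be a complex unital Banach algebra and let $a,d\in\mathcal{B}$. Assume that $d$ is regular, i.e. $d=dxd$ for some $x\in\mathcal{B}$, and that $a$ is invertible along $d$, i.e. there exists $b\in\mathcal{B}$ with $bab=b$, $b\mathcal{B}=d\mathcal{B}$ and $\mathcal{B}b=\mathcal{B}d$; such a $b$ is unique and is denoted by $a^{\parallel d}$. If the spectrum of $da$ satisfies $\sigma(da)\setminus\{0\}\subset\{z\in\mathbb{C}:\operatorname{Re}z>0\}$, then $t\mapsto \exp(-t\,da)\,d$ is integrable on $(0,\infty)$ and $$\int_0^\infty \exp(-t\,da)\,d\;\mathrm{d}t=a^{\parallel d}.$$ -/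

import Mathlib

/-- An element `d` of a ring is regular if it has an inner inverse: `d * x * d = d` for some `x`. -/
def IsInnerRegular {R : Type*} [Ring R] (d : R) : Prop :=
  ∃ x : R, d = d * x * d

/-- `b` is an inverse of `a` along `d`: `b a b = b`, `b R = d R` and `R b = R d`. -/
structure IsInverseAlong {R : Type*} [Ring R] (a d b : R) : Prop where
  outer : b * a * b = b
  right_image : Set.range (fun x : R => b * x) = Set.range (fun x : R => d * x)
  left_image : Set.range (fun x : R => x * b) = Set.range (fun x : R => x * d)

/-- `a` is invertible along `d`. -/
def InvertibleAlong {R : Type*} [Ring R] (a d : R) : Prop :=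
  ∃ b : R, IsInverseAlong a d b

/-- An inverse of `a` along `d` is unique. -/
theorem IsInverseAlong.unique {R : Type*} [Ring R] {a d b c : R}
    (hb : IsInverseAlong a d b) (hc : IsInverseAlong a d c) : b = c := by
  obtain ⟨x, hx⟩ : c ∈ Set.range (fun x : R => b * x) := by
    rw [hb.right_image, ← hc.right_image]
    exact ⟨1, mul_one c⟩
  obtain ⟨y, hy⟩ : b ∈ Set.range (fun x : R => x * c) := by
    rw [hc.left_image, ← hb.left_image]
    exact ⟨1, one_mul b⟩
  have hx' : b * x = c := hx
  have hy' : y * c = b := hy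
  calc b = y * (c * a * c) := by rw [hc.outer, hy']
    _ = b * a * c := by rw [← mul_assoc, ← mul_assoc, hy']
    _ = b * a * b * x := by rw [mul_assoc (b * a), hx']
    _ = c := by rw [hb.outer, hx']

/-- The inverse of `a` along `d`, for `a` invertible along `d`. -/
noncomputable def inverseAlong {R : Type*} [Ring R] (a d : R) (h : InvertibleAlong a d) : R :=
  Classical.choose h

theorem inverseAlong_spec {R : Type*} [Ring R] {a d : R} (h : InvertibleAlong a d) :
    IsInverseAlong a d (inverseAlong a d h) :=
  Classical.choose_spec h

/-! Write `b` for the inverse along `d`, and let `p = b * a`, `c = d * a + (1 - p)`. Then `p` is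
idempotent and `1 - p` kills `d * a` on both sides and `d` from the left, so `exp (-t c) d = exp (-t
d a) d`. Since `c` is invertible (`IsInverseAlong.isUnit_add`), its spectrum loses the possible `0`
of `d * a` and gains at most `1`, so it lies in the open right half-plane. Spectral mapping and
Gelfand's formula then make `exp (-t c)` decay exponentially. As `c * b = d`, `-exp (-t c) b` is a
primitive of the integrand, running from `-b` to `0`. -/

/-- A one-parameter semigroup with an element of norm less than one decays exponentially. -/
theorem exists_norm_le_exp_of_norm_lt_one {B : Type*} [NormedRing B] {f : ℝ → B}
    (hf : Continuous f) (hadd : ∀ s t, f (s + t) = f s * f t) {N : ℝ} (hN : 0 < N)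
    (hfN : ‖f N‖ < 1) :
    ∃ M ε : ℝ, 0 < ε ∧ ∀ t, 0 ≤ t → ‖f t‖ ≤ M * Real.exp (-ε * t) := by
  obtain ⟨r, hqr, hr1⟩ := exists_between hfN
  have hr0 : 0 < r := (norm_nonneg _).trans_lt hqr
  obtain ⟨M, hM⟩ := (isCompact_Icc (a := (0 : ℝ)) (b := N)).exists_bound_of_continuousOn
    hf.continuousOn
  have hM0 : 0 ≤ M := (norm_nonneg _).trans (hM 0 ⟨le_rfl, hN.le⟩)
  have hlog : Real.log r < 0 := Real.log_neg hr0 hr1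
  have hstep : ∀ (k : ℕ) (s : ℝ), ‖f (k * N + s)‖ ≤ r ^ k * ‖f s‖ := by
    intro k s
    induction k with
    | zero => simp
    | succ k ih =>
      have h : ((k + 1 : ℕ) : ℝ) * N + s = N + (k * N + s) := by push_cast; ring
      rw [h, hadd, pow_succ']
      calc ‖f N * f (k * N + s)‖ ≤ ‖f N‖ * ‖f (k * N + s)‖ := norm_mul_le _ _
        _ ≤ r * (r ^ k * ‖f s‖) := by gcongr
        _ = r * r ^ k * ‖f s‖ := by ring
  -- The factor `exp (-log r) = 1 / r` pays for rounding `t / N` down to `k`: `r ^ k ≤ r ^ (t / N -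
  -- 1)`.
  refine ⟨M * Real.exp (-Real.log r), -Real.log r / N, div_pos (neg_pos.2 hlog) hN,
    fun t ht => ?_⟩
  set k := ⌊t / N⌋₊
  have hk1 : (k : ℝ) * N ≤ t := (le_div_iff₀ hN).1 (Nat.floor_le (by positivity))
  have hk2 : t / N < k + 1 := Nat.lt_floor_add_one _
  have hk3 : t < (k + 1) * N := (div_lt_iff₀ hN).1 hk2
  have hs := hstep k (t - k * N)
  rw [add_sub_cancel] at hs
  have hb := hM (t - k * N) ⟨by linarith, by linarith⟩
  have hrk : r ^ k ≤ Real.exp (-Real.log r) * Real.exp (-(-Real.log r / N) * t) := by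
    rw [← Real.exp_add, ← Real.exp_log (pow_pos hr0 k), Real.log_pow]
    apply Real.exp_le_exp.2
    have h : -(-Real.log r / N) * t = Real.log r * (t / N) := by ring
    rw [h]
    nlinarith
  calc ‖f t‖ ≤ r ^ k * ‖f (t - k * N)‖ := hs
    _ ≤ (Real.exp (-Real.log r) * Real.exp (-(-Real.log r / N) * t)) * M := by gcongr
    _ = M * Real.exp (-Real.log r) * Real.exp (-(-Real.log r / N) * t) := by ring

/-- One inclusion of the spectral mapping theorem for the exponential. -/
theorem spectrum_exp_subset {B : Type*} [NormedRing B] [NormedAlgebra ℂ B] [CompleteSpace B]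
    (x : B) : spectrum ℂ (NormedSpace.exp x) ⊆ Complex.exp '' spectrum ℂ x := by
  -- The bicommutant of `x` is closed and commutative, so characters compute spectra in it.
  set C : Subalgebra ℂ B := Subalgebra.centralizer ℂ (Subalgebra.centralizer ℂ ({x} : Set B))
  have hC : ∀ y : B, y ∈ C ↔ ∀ g : B, g * x = x * g → g * y = y * g := by
    intro y
    simp only [C, Subalgebra.mem_centralizer_iff, SetLike.mem_coe, Set.mem_singleton_iff,
      forall_eq]
    exact forall_congr' fun g => imp_congr_left eq_comm
  have hxC : x ∈ C := (hC x).2 fun g hg => hg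
  have hclosed : IsClosed (C : Set B) := by
    have : (C : Set B) = ⋂ (g : B) (_ : g * x = x * g), {y | g * y = y * g} := by
      ext y
      simp [hC]
    rw [this]
    exact isClosed_biInter fun g _ =>
      isClosed_eq (continuous_const.mul continuous_id) (continuous_id.mul continuous_const)
  have : CompleteSpace C := hclosed.completeSpace_coe
  let _ : NormedCommRing C :=
    { (inferInstance : NormedRing C) with
      mul_comm := fun y z => Subtype.ext <| (hC z).1 z.2 y <| ((hC y).1 y.2 x rfl).symm }
  intro w hw
  let _ : NormedAlgebra ℚ B := .restrictScalars ℚ ℂ B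
  let _ : NormedAlgebra ℚ C := .restrictScalars ℚ ℂ C
  have hexp : (C.val (NormedSpace.exp (⟨x, hxC⟩ : C)) : B) = NormedSpace.exp x :=
    NormedSpace.map_exp C.val continuous_subtype_val _
  rw [← hexp] at hw
  obtain ⟨φ, hφ⟩ := WeakDual.CharacterSpace.mem_spectrum_iff_exists.1
    (AlgHom.spectrum_apply_subset C.val _ hw)
  refine ⟨φ ⟨x, hxC⟩, fun hu => ?_, ?_⟩
  · have hmem : φ ⟨x, hxC⟩ ∈ spectrum ℂ (⟨x, hxC⟩ : C) :=
      WeakDual.CharacterSpace.mem_spectrum_iff_exists.2 ⟨φ, rfl⟩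
    apply hmem
    obtain ⟨u, hu⟩ := hu
    -- The bicommutant is closed under inverses, so a spectral value of `x` in `C` is one in `B`.
    have huC : (↑u⁻¹ : B) ∈ C := (hC _).2 fun g hg => by
      have : Commute g (u : B) := by
        rw [hu]
        exact Commute.sub_right (Algebra.commutes _ g).symm hg
      exact this.units_inv_right
    refine IsUnit.of_mul_eq_one ⟨(↑u⁻¹ : B), huC⟩ (Subtype.ext ?_)
    change (algebraMap ℂ B (φ ⟨x, hxC⟩) - x) * ↑u⁻¹ = 1
    rw [← hu, Units.mul_inv]
  · rw [← hφ, Complex.exp_eq_exp_ℂ]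
    exact (NormedSpace.map_exp φ (map_continuous φ) _).symm

open Filter Topology in
/-- An element of spectral radius less than one has a power of norm less than one. -/
theorem exists_norm_pow_lt_one {B : Type*} [NormedRing B] [NormedAlgebra ℂ B] [CompleteSpace B]
    {u : B} (hu : spectralRadius ℂ u < 1) : ∃ n : ℕ, 0 < n ∧ ‖u ^ n‖ < 1 := by
  have h := (spectrum.pow_nnnorm_pow_one_div_tendsto_nhds_spectralRadius u).eventually_lt_const hu
  obtain ⟨n, hn, hn0⟩ := (h.and (eventually_gt_atTop 0)).exists
  refine ⟨n, hn0, ?_⟩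
  by_contra! hc
  refine hn.not_ge (ENNReal.one_le_rpow ?_ (by positivity))
  exact_mod_cast hc

/-- If the spectrum of `x` lies in the open right half-plane, `exp (-t x)` decays exponentially. -/
theorem exists_norm_exp_neg_smul_le {B : Type*} [NormedRing B] [NormedAlgebra ℂ B]
    [CompleteSpace B] {x : B} (hx : ∀ z ∈ spectrum ℂ x, 0 < z.re) :
    ∃ M ε : ℝ, 0 < ε ∧ ∀ t : ℝ, 0 ≤ t →
      ‖NormedSpace.exp (-((t : ℂ) • x))‖ ≤ M * Real.exp (-ε * t) := by
  let _ : NormedAlgebra ℚ B := .restrictScalars ℚ ℂ B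
  cases subsingleton_or_nontrivial B with
  | inl _ =>
    refine ⟨0, 1, one_pos, fun t _ => ?_⟩
    rw [Subsingleton.elim (NormedSpace.exp (-((t : ℂ) • x))) 0]
    simp
  | inr _ =>
    have hr : spectralRadius ℂ (NormedSpace.exp (-x)) < (1 : NNReal) := by
      refine spectrum.spectralRadius_lt_of_forall_lt _ fun w hw => ?_
      obtain ⟨z, hz, rfl⟩ := spectrum_exp_subset (-x) hw
      rw [← spectrum.neg_eq, Set.mem_neg] at hz
      have h := hx _ hz
      rw [← NNReal.coe_lt_coe, coe_nnnorm, Complex.norm_exp, NNReal.coe_one, Real.exp_lt_one_iff]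
      simpa using h
    obtain ⟨n, hn, hlt⟩ := exists_norm_pow_lt_one hr
    refine exists_norm_le_exp_of_norm_lt_one
      (f := fun t : ℝ => NormedSpace.exp (-((t : ℂ) • x))) ?_ ?_ (N := n) (by exact_mod_cast hn) ?_
    · exact NormedSpace.exp_continuous.comp (by fun_prop)
    · intro s t
      rw [← NormedSpace.exp_add_of_commute]
      · rw [Complex.ofReal_add, add_smul, neg_add]
      · exact ((((Commute.refl x).smul_left _).smul_right _).neg_left).neg_right
    · rw [← NormedSpace.exp_nsmul] at hlt
      simpa [Nat.cast_smul_eq_nsmul] using hlt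

/-- Right multiplication by `d` intertwines the exponentials of `x` and `x + y` when `x` and `y`
commute and `y` annihilates `d`. -/
theorem exp_add_mul_eq {B : Type*} [NormedRing B] [NormedAlgebra ℂ B] [CompleteSpace B]
    {x y d : B} (hxy : Commute x y) (hyd : y * d = 0) :
    NormedSpace.exp (x + y) * d = NormedSpace.exp x * d := by
  let _ : NormedAlgebra ℚ B := .restrictScalars ℚ ℂ B
  have hy : NormedSpace.exp y * d = d := by
    have h := (NormedSpace.exp_series_hasSum_exp' (𝕂 := ℂ) y).mul_right d
    refine h.unique ?_
    have hterm : (fun n : ℕ => ((n.factorial : ℂ)⁻¹ • y ^ n) * d)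
        = fun n => if n = 0 then d else 0 := by
      funext n
      cases n with
      | zero => simp
      | succ n => simp [pow_succ, mul_assoc, hyd]
    rw [hterm]
    exact hasSum_ite_eq 0 d
  rw [NormedSpace.exp_add_of_commute hxy, mul_assoc, hy]

/-- If `x y = 0 = y x` with `y` idempotent and `x + y` invertible, then the spectrum of `x + y`
is contained in that of `x` with `0` removed and `1` added. -/
theorem spectrum_add_idempotent_subset {B : Type*} [Ring B] [Algebra ℂ B] {x y : B}
    (hxy : x * y = 0) (hy : IsIdempotentElem y) (hunit : IsUnit (x + y)) :
    spectrum ℂ (x + y) ⊆ insert 1 (spectrum ℂ x \ {0}) := by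
  intro z hz
  have hz0 : z ≠ 0 := by
    rintro rfl
    exact spectrum.zero_notMem_iff ℂ |>.2 hunit hz
  by_contra hcon
  simp only [Set.mem_insert_iff, Set.mem_sdiff, Set.mem_singleton_iff, not_or, hz0,
    not_false_eq_true, and_true] at hcon
  have h1 : IsUnit (algebraMap ℂ B z - x) := spectrum.notMem_iff.1 hcon.2
  have h2 : IsUnit (algebraMap ℂ B z - y) := by
    refine spectrum.notMem_iff.1 fun h => ?_
    rcases hy.spectrum_subset ℂ h with h | h
    · exact hz0 h
    · exact hcon.1 h
  -- The cross term `x * y` vanishes, so the resolvent factors multiply.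
  have h3 : (algebraMap ℂ B z - x) * (algebraMap ℂ B z - y)
      = algebraMap ℂ B z * (algebraMap ℂ B z - (x + y)) := by
    rw [sub_mul, mul_sub, mul_sub, hxy, ← Algebra.commutes z x, mul_sub, mul_add]
    abel
  have h4 : IsUnit (algebraMap ℂ B z) := (isUnit_iff_ne_zero.2 hz0).map (algebraMap ℂ B)
  have h5 := h1.mul h2
  rw [h3] at h5
  exact hz (h4.mul_left_iff.1 h5)

theorem IsInverseAlong.mul_mul_left {R : Type*} [Ring R] {a d b : R} (h : IsInverseAlong a d b) :
    b * a * d = d := by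
  obtain ⟨x, hx⟩ : d ∈ Set.range (fun x : R => b * x) := by
    rw [h.right_image]
    exact ⟨1, mul_one d⟩
  have hx' : b * x = d := hx
  rw [← hx', ← mul_assoc, h.outer]

theorem IsInverseAlong.mul_mul_right {R : Type*} [Ring R] {a d b : R} (h : IsInverseAlong a d b) :
    d * a * b = d := by
  obtain ⟨x, hx⟩ : d ∈ Set.range (fun x : R => x * b) := by
    rw [h.left_image]
    exact ⟨1, one_mul d⟩
  have hx' : x * b = d := hx
  rw [← hx', mul_assoc, mul_assoc, ← mul_assoc b, h.outer]

/-- `d a + (1 - b a)` is invertible when `b` is an inverse of `a` along `d`. -/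
theorem IsInverseAlong.isUnit_add {R : Type*} [Ring R] {a d b : R} (h : IsInverseAlong a d b) :
    IsUnit (d * a + (1 - b * a)) := by
  obtain ⟨u, hu⟩ : b ∈ Set.range (fun x : R => d * x) := by
    rw [← h.right_image]
    exact ⟨1, mul_one b⟩
  obtain ⟨v, hv⟩ : b ∈ Set.range (fun x : R => x * d) := by
    rw [← h.left_image]
    exact ⟨1, one_mul b⟩
  have hu' : d * u = b := hu
  have hv' : v * d = b := hv
  have hl := h.mul_mul_left
  have hr := h.mul_mul_right
  have hp : b * a * (b * a) = b * a := by rw [← mul_assoc, h.outer]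
  have hcp : d * a * (b * a) = d * a := by rw [← mul_assoc, hr]
  have hpc : b * a * (d * a) = d * a := by rw [← mul_assoc, hl]
  generalize hpdef : b * a = p at *
  have hright : d * a * (b * u * a) = p := by
    rw [← mul_assoc, ← mul_assoc, hr, hu', hpdef]
  have hleft : v * (d * a) = p := by rw [← mul_assoc, hv', hpdef]
  have hq : p * (1 - p) = 0 := by rw [mul_sub, mul_one, hp, sub_self]
  have hq' : (1 - p) * p = 0 := by rw [sub_mul, one_mul, hp, sub_self]
  have hqq : (1 - p) * (1 - p) = 1 - p := by rw [mul_sub, mul_one, hq', sub_zero]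
  have hqc : (1 - p) * (d * a) = 0 := by rw [sub_mul, one_mul, hpc, sub_self]
  have hcq : d * a * (1 - p) = 0 := by rw [mul_sub, mul_one, hcp, sub_self]
  -- The one-sided inverses are block diagonal for `p` and `1 - p`: from `d * u = b = v * d`, the
  -- `p` block of `d * a` has right inverse `b * u * a` and left inverse `v * p`, up to
  -- multiplication by `p`.
  refine isUnit_iff_exists_and_exists.2
    ⟨⟨p * (b * u * a) + (1 - p), ?_⟩, ⟨v * p + (1 - p), ?_⟩⟩
  · rw [add_mul, mul_add, mul_add, ← mul_assoc (d * a), hcp, hright, hcq, ← mul_assoc (1 - p), hq',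
      hqq, zero_mul]
    abel
  · rw [add_mul, mul_add, mul_add, mul_assoc v, hpc, hleft, mul_assoc v, hq, hqc, hqq, mul_zero]
    abel

open MeasureTheory in
theorem mainTheorem11 {B : Type*} [NormedRing B] [NormedAlgebra ℂ B] [CompleteSpace B]
    (a d : B) (hd : IsInnerRegular d) (h : InvertibleAlong a d)
    (hspec : spectrum ℂ (d * a) \ {0} ⊆ {z : ℂ | 0 < z.re}) :
    MeasureTheory.IntegrableOn
        (fun t : ℝ => NormedSpace.exp (-((t : ℂ) • (d * a))) * d) (Set.Ioi 0)
        MeasureTheory.volume ∧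
      ∫ t in Set.Ioi (0 : ℝ), NormedSpace.exp (-((t : ℂ) • (d * a))) * d
        = inverseAlong a d h := by
  let _ : NormedAlgebra ℚ B := .restrictScalars ℚ ℂ B
  have hb := inverseAlong_spec h
  set b := inverseAlong a d h
  have hl := hb.mul_mul_left
  have hr := hb.mul_mul_right
  have hp : IsIdempotentElem (b * a) := by
    rw [IsIdempotentElem, ← mul_assoc, hb.outer]
  have hcq : d * a * (1 - b * a) = 0 := by rw [mul_sub, mul_one, ← mul_assoc, hr, sub_self]
  have hqd : (1 - b * a) * d = 0 := by rw [sub_mul, one_mul, hl, sub_self]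
  have hqb : (1 - b * a) * b = 0 := by rw [sub_mul, one_mul, hb.outer, sub_self]
  have hqc : (1 - b * a) * (d * a) = 0 := by rw [← mul_assoc, hqd, zero_mul]
  set c := d * a + (1 - b * a) with hc
  have hcb : c * b = d := by rw [hc, add_mul, hr, hqb, add_zero]
  have hpos : ∀ z ∈ spectrum ℂ c, 0 < z.re := by
    intro z hz
    rcases spectrum_add_idempotent_subset hcq hp.one_sub hb.isUnit_add hz with rfl | hz
    · simp
    · exact hspec hz
  have heq : (fun t : ℝ => NormedSpace.exp (-((t : ℂ) • (d * a))) * d)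
      = fun t : ℝ => NormedSpace.exp (-((t : ℂ) • c)) * d := by
    funext t
    rw [hc, smul_add, neg_add]
    refine (exp_add_mul_eq ?_ ?_).symm
    · refine Commute.neg_left (Commute.neg_right (Commute.smul_left (Commute.smul_right ?_ _) _))
      exact hcq.trans hqc.symm
    · rw [neg_mul, smul_mul_assoc, hqd, smul_zero, neg_zero]
  obtain ⟨M, ε, hε, hM⟩ := exists_norm_exp_neg_smul_le hpos
  have hcont : Continuous fun t : ℝ => NormedSpace.exp (-((t : ℂ) • c)) :=
    NormedSpace.exp_continuous.comp (by fun_prop)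
  have hint : IntegrableOn (fun t : ℝ => NormedSpace.exp (-((t : ℂ) • c)) * d) (Set.Ioi 0) := by
    refine Integrable.mul_const (Integrable.mono' ((exp_neg_integrableOn_Ioi 0 hε).const_mul M)
      hcont.aestronglyMeasurable ?_) d
    exact (ae_restrict_iff' measurableSet_Ioi).2 (.of_forall fun t ht => hM t (le_of_lt ht))
  rw [heq]
  refine ⟨hint, ?_⟩
  have hderiv : ∀ t ∈ Set.Ici (0 : ℝ),
      HasDerivAt (fun t : ℝ => -(NormedSpace.exp (-((t : ℂ) • c)) * b))
        (NormedSpace.exp (-((t : ℂ) • c)) * d) t := by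
    intro t _
    have h1 := ((hasDerivAt_exp_smul_const (𝕂 := ℝ) (-c) t).mul_const b).neg
    simp only [smul_neg, ← Complex.coe_smul] at h1
    rw [mul_assoc, neg_mul, hcb, mul_neg, neg_neg] at h1
    exact h1
  have htend : Filter.Tendsto (fun t : ℝ => -(NormedSpace.exp (-((t : ℂ) • c)) * b)) Filter.atTop
      (nhds 0) := by
    have hE : Filter.Tendsto (fun t : ℝ => NormedSpace.exp (-((t : ℂ) • c))) Filter.atTop
        (nhds 0) := by
      refine squeeze_zero_norm' (a := fun t => M * Real.exp (-ε * t)) ?_ ?_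
      · filter_upwards [Filter.eventually_ge_atTop 0] with t ht using hM t ht
      · have := (Real.tendsto_exp_atBot.comp
          (Filter.tendsto_id.const_mul_atTop_of_neg (neg_neg_of_pos hε))).const_mul M
        simpa using this
    simpa using (hE.mul_const b).neg
  rw [integral_Ioi_of_hasDerivAt_of_tendsto' hderiv hint htend]
  simp
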